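/- Let $m\ge 0$ and let $0=k_0<k_1<\dots<k_m<k_{m+1}=d$ be integers. Let $K$ be an algebraically closed field of characteristic $0$ (for instance $\mathbb C$, or an algebraic closure of the field of rational functions $\mathbb C(x_0,x_{k_1},\dots,x_{k_m},x_d)$ with the $x$'s as indeterminates), let $x=(x_0,x_{k_1},\dots,x_{k_m},x_d)\in K^{m+2}$ with $x_d\ne 0$, and let $$f(x;t)=x_0+x_{k_1}t^{k_1}+\dots+x_{k_m}t^{k_m}+x_dt^d .$$ Let $\rho_1,\dots,\rho_d$ be the roots of $f(x;t)$ in $K$, listed with multiplicity, and put $p_s(x)=\rho_1^s+\dots+\rho_d^s$ for $s\in\mathbb Z$ (if $s<0$, assume $x_0\neq 0$). Let $\mathcal B$ and $\mathcal C$ be the $2\times(m+1)$ matrices with columns $(1,k_0),\dots,(1,k_m)$ and $(1,k_1),\dots,(1,k_m),(1,d)$ respectively, and put $x'=(x_0,x_{k_1},\dots,x_{k_m})$ and $\tilde x=(x_{k_1},\dots,x_{k_m},x_d)$. For a $2\times n$ integer matrix $A$ with first row $(1,\dots,1)$ and $\beta\in\mathbb Z^2$ let $$\Phi^{A}(\beta;y)=\sum_{u\in\mathbb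 N^n,\ A u=\beta}\frac{y_1^{u_1}\cdots y_n^{u_n}}{u_1!\cdots u_n!},$$ which is $0$ if there is no such $u$, and for $\alpha\in\mathbb Z^2$ let $$\Psi_d^{\mathcal A}(\alpha;x)=\sum_{r\ge1}(-1)^r(r-1)!\,\frac{\Phi^{\mathcal B}(\alpha+r(1,d);x')}{x_d^r},\qquad \Psi_0^{\mathcal A}(\alpha;x)=\sum_{r\ge1}(-1)^r(r-1)!\,\frac{\Phi^{\mathcal C}(\alpha+r(1,0);\tilde x)}{x_0^r}$$ (all these sums are finite, so that $\Psi_d^{\mathcal A}$ and $\Psi_0^{\mathcal A}$ are Laurent polynomials in $x$). (1) For every integer $s>0$, $$p_s(x)=s\,\Psi_d^{\mathcal A}((0,-s);x)=s\sum_{r=1}^{s}(-1)^r(r-1)!\,\frac{\Phi^{\mathcal B}((r,rd-s);x')}{x_d^r}.$$ (2) If $x_0\ne0$, then for every integer $s<0$, $$p_s(x)=-s\,\Psi_0^{\mathcal A}((0,-s);x)=-s\sum_{r=1}^{-s}(-1)^r(r-1)!\,\frac{\Phi^{\mathcal C}((r,-s);\tilde x)}{x_0^r}.$$ (3) (Girard's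 formula) With $\sigma_j$ the $j$-th elementary symmetric polynomial of $\rho_1,\dots,\rho_d$, for every integer $s>0$, $$p_s(x)=s\sum_{\substack{i_1,\dots,i_d\ge0\\ i_1+2i_2+\dots+d i_d=s}}(-1)^{s+i_1+\dots+i_d}\,\frac{(i_1+\dots+i_d-1)!}{i_1!\cdots i_d!}\,\sigma_1^{i_1}\cdots\sigma_d^{i_d}.$$ -/

import Mathlib

open scoped Nat

namespace MonomialCurve

/-- The `2 × n` integer matrix whose columns are the vectors `(1, k_j)`. -/
def curveMatrix {n : ℕ} (k : Fin n → ℕ) : Matrix (Fin 2) (Fin n) ℤ :=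
  Matrix.of ![fun _ => 1, fun j => (k j : ℤ)]

/-- The vectors `u` with entries in `ℕ` such that `A · u = α`. -/
def fiber {n : ℕ} (A : Matrix (Fin 2) (Fin n) ℤ) (α : Fin 2 → ℤ) : Set (Fin n →₀ ℕ) :=
  {u | A.mulVec (fun j => (u j : ℤ)) = α}

/-- The hypergeometric polynomial `Φ^A(α; x) = ∑_{u ∈ ℕ^n, A·u = α} x^u / u!`. The sum is
finite for the matrices `curveMatrix k` by `fiber_finite`, and it is `0` if no such `u` exists. -/
noncomputable def hypPoly (K : Type*) [Field K] {n : ℕ} (A : Matrix (Fin 2) (Fin n) ℤ)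
    (α : Fin 2 → ℤ) : MvPolynomial (Fin n) K :=
  ∑ᶠ u ∈ fiber A α, MvPolynomial.monomial u (∏ j, ((u j)! : K))⁻¹

/-- The matrix with columns `(1, k_0), …, (1, k_m)`: the last column is dropped. -/
def matB {m : ℕ} (k : Fin (m + 2) → ℕ) : Matrix (Fin 2) (Fin (m + 1)) ℤ :=
  curveMatrix (fun j => k j.castSucc)

/-- The matrix with columns `(1, k_1), …, (1, k_{m+1})`: the first column is dropped. -/
def matC {m : ℕ} (k : Fin (m + 2) → ℕ) : Matrix (Fin 2) (Fin (m + 1)) ℤ :=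
  curveMatrix (fun j => k j.succ)

/-- The largest exponent `d = k_{m+1}`. -/
def deg {m : ℕ} (k : Fin (m + 2) → ℕ) : ℕ := k (Fin.last (m + 1))

/-- The value at `x` of the Laurent polynomial
`Ψ_d(α; x) = ∑_{r ≥ 1} (-1)^r (r-1)! Φ^B(α + r(1,d); x') / x_d^r`, where `x'` omits the last
variable `x_d`. Only finitely many of the `Φ^B` are nonzero, by `hypPoly_matB_finite`. -/
noncomputable def PsiD {K : Type*} [Field K] {m : ℕ} (k : Fin (m + 2) → ℕ) (α : Fin 2 → ℤ)
    (x : Fin (m + 2) → K) : K :=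
  ∑ᶠ (r : ℕ) (_ : 1 ≤ r), (-1 : K) ^ r * ((r - 1)! : K) *
    (MvPolynomial.eval (fun j : Fin (m + 1) => x j.castSucc)
      (hypPoly K (matB k) (α + (r : ℤ) • ![1, (deg k : ℤ)])) / x (Fin.last (m + 1)) ^ r)

/-- The value at `x` of the Laurent polynomial
`Ψ_0(α; x) = ∑_{r ≥ 1} (-1)^r (r-1)! Φ^C(α + r(1,0); x̃) / x_0^r`, where `x̃` omits the first
variable `x_0`. Only finitely many of the `Φ^C` are nonzero, by `hypPoly_matC_finite`. -/
noncomputable def PsiZero {K : Type*} [Field K] {m : ℕ} (k : Fin (m + 2) → ℕ) (α : Fin 2 → ℤ)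
    (x : Fin (m + 2) → K) : K :=
  ∑ᶠ (r : ℕ) (_ : 1 ≤ r), (-1 : K) ^ r * ((r - 1)! : K) *
    (MvPolynomial.eval (fun j : Fin (m + 1) => x j.succ)
      (hypPoly K (matC k) (α + (r : ℤ) • ![1, 0])) / x 0 ^ r)

/-- The polynomial `f(x; t) = ∑_j x_j t^{k_j}` in `t` with coefficients `x`. -/
noncomputable def genPoly {K : Type*} [Field K] {m : ℕ} (k : Fin (m + 2) → ℕ)
    (x : Fin (m + 2) → K) : Polynomial K :=
  ∑ j, Polynomial.C (x j) * Polynomial.X ^ k j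

/-- The power sum `p_s(x) = ∑ ρ^s` over the roots `ρ` of `f(x; t)`, counted with multiplicity. -/
noncomputable def powerSum {K : Type*} [Field K] {m : ℕ} (k : Fin (m + 2) → ℕ)
    (x : Fin (m + 2) → K) (s : ℤ) : K :=
  ((genPoly k x).roots.map (fun ρ => ρ ^ s)).sum

/-- The tuples `(i_1, …, i_d)` of natural numbers with `i_1 + 2 i_2 + ⋯ + d i_d = s`; the entry
`i_j` is stored at position `j - 1`. Each entry is at most `s`. -/
def girardIndex (d s : ℕ) : Finset (Fin d → ℕ) :=
  (Fintype.piFinset fun _ : Fin d => Finset.range (s + 1)).filter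
    (fun i => ∑ j : Fin d, ((j : ℕ) + 1) * i j = s)

theorem mem_girardIndex {d s : ℕ} {i : Fin d → ℕ} :
    i ∈ girardIndex d s ↔ ∑ j : Fin d, ((j : ℕ) + 1) * i j = s := by
  simp only [girardIndex, Finset.mem_filter, Fintype.mem_piFinset, Finset.mem_range,
    and_iff_right_iff_imp]
  intro h j
  have h1 := Finset.single_le_sum (f := fun j : Fin d => ((j : ℕ) + 1) * i j)
    (fun _ _ => Nat.zero_le _) (Finset.mem_univ j)
  nlinarith

theorem mem_fiber_curveMatrix {n : ℕ} {k : Fin n → ℕ} {α : Fin 2 → ℤ} {u : Fin n →₀ ℕ} :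
    u ∈ fiber (curveMatrix k) α ↔
      ∑ j, (u j : ℤ) = α 0 ∧ ∑ j, (k j : ℤ) * (u j : ℤ) = α 1 := by
  simp [fiber, curveMatrix, funext_iff, Fin.forall_fin_two, dotProduct]

theorem fiber_finite {n : ℕ} (k : Fin n → ℕ) (α : Fin 2 → ℤ) :
    (fiber (curveMatrix k) α).Finite := by
  refine ((Finset.univ : Finset (Fin n)).finsuppAntidiag (α 0).toNat).finite_toSet.subset ?_
  intro u hu
  have h := (mem_fiber_curveMatrix.1 hu).1
  simp only [Finset.mem_coe, Finset.mem_finsuppAntidiag, Finset.subset_univ, and_true]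
  rw [← h, ← Nat.cast_sum, Int.toNat_natCast]

theorem exists_mem_fiber {K : Type*} [Field K] {n : ℕ} {A : Matrix (Fin 2) (Fin n) ℤ}
    {α : Fin 2 → ℤ} (h : hypPoly K A α ≠ 0) : ∃ u, u ∈ fiber A α := by
  by_contra! hne
  apply h
  simp [hypPoly, hne]

theorem hypPoly_matB_finite (K : Type*) [Field K] {m : ℕ} {k : Fin (m + 2) → ℕ}
    (hk : StrictMono k) (α : Fin 2 → ℤ) :
    {r : ℕ | hypPoly K (matB k) (α + (r : ℤ) • ![1, (deg k : ℤ)]) ≠ 0}.Finite := by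
  refine (Set.finite_Iic (((deg k : ℤ) - 1) * α 0 - α 1).toNat).subset ?_
  intro r hr
  obtain ⟨u, hu⟩ := exists_mem_fiber hr
  obtain ⟨h0, h1⟩ := mem_fiber_curveMatrix.1 hu
  simp at h0 h1
  have hle : ∑ j : Fin (m + 1), (k j.castSucc : ℤ) * (u j : ℤ)
      ≤ ((deg k : ℤ) - 1) * ∑ j, (u j : ℤ) := by
    rw [Finset.mul_sum]
    refine Finset.sum_le_sum fun j _ => mul_le_mul_of_nonneg_right ?_ (by positivity)
    have : k j.castSucc < deg k := hk (Fin.castSucc_lt_last j)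
    omega
  rw [h0, h1] at hle
  simp only [Set.mem_Iic]
  have : (r : ℤ) ≤ ((deg k : ℤ) - 1) * α 0 - α 1 := by linarith
  omega

theorem hypPoly_matC_finite (K : Type*) [Field K] {m : ℕ} {k : Fin (m + 2) → ℕ}
    (hk : StrictMono k) (α : Fin 2 → ℤ) :
    {r : ℕ | hypPoly K (matC k) (α + (r : ℤ) • ![1, 0]) ≠ 0}.Finite := by
  refine (Set.finite_Iic (α 1 - α 0).toNat).subset ?_
  intro r hr
  obtain ⟨u, hu⟩ := exists_mem_fiber hr
  obtain ⟨h0, h1⟩ := mem_fiber_curveMatrix.1 hu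
  simp at h0 h1
  have hle : ∑ j, (u j : ℤ) ≤ ∑ j : Fin (m + 1), (k j.succ : ℤ) * (u j : ℤ) := by
    refine Finset.sum_le_sum fun j _ => le_mul_of_one_le_left (by positivity) ?_
    have : k 0 < k j.succ := hk (Fin.succ_pos j)
    omega
  rw [h0, h1] at hle
  simp only [Set.mem_Iic]
  omega

end MonomialCurve

/-! If `∏ (1 - ρX) = 1 + H` with `X ∣ H`, then `-∑ p_s X^s / s = log (1 + H) = -∑ (-1)^r H^r / r`.
When `H = ∑ a_j X^{e_j}` with all `e_j > 0`, the multinomial theorem gives `r! ∑ a^u / u!`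
(`weightSum`) as the coefficient of `X^s` in `H^r`, and `r!/r = (r-1)!`. This is
`sum_pow_eq_sum_weightSum`; each formula is an instance of it. Positive powers: reversing `f / x_d`
gives `a_j = x_{k_j} / x_d`, `e_j = d - k_j`. Negative powers: `f / x_0` is already the product for
the inverse roots, with `e_j = k_j`. Girard: by Vieta, `a_j = (-1)^j σ_j`, `e_j = j`. -/

namespace MonomialCurve

open Finset Polynomial

/-! ### Logarithm of a product of linear factors -/

section Core

variable {K : Type*} [Field K]

/-- The coefficient sum `∑ a^u / u!` over all `u ∈ ℕ^ι` with `∑ u_j = r` and `∑ e_j u_j = s`. -/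
noncomputable def weightSum {ι : Type*} [Fintype ι] [DecidableEq ι] (a : ι → K) (e : ι → ℕ)
    (r s : ℕ) : K :=
  ∑ u ∈ (piAntidiag univ r).filter (fun u : ι → ℕ => ∑ j, e j * u j = s),
    (∏ j, a j ^ u j) * (∏ j, ((u j)! : K))⁻¹

theorem coeff_pow_sum_C_mul_X_pow [CharZero K] {ι : Type*} [Fintype ι] [DecidableEq ι]
    (a : ι → K) (e : ι → ℕ) (r s : ℕ) :
    ((∑ j, C (a j) * X ^ e j : K[X]) ^ r).coeff s = (r ! : K) * weightSum a e r s := by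
  rw [sum_pow_eq_sum_piAntidiag, finsetSum_coeff, weightSum, Finset.mul_sum, Finset.sum_filter]
  refine Finset.sum_congr rfl fun u hu => ?_
  have hprod : ∏ j, (C (a j) * X ^ e j : K[X]) ^ u j
      = C (∏ j, a j ^ u j) * X ^ (∑ j, e j * u j) := by
    simp only [mul_pow, Finset.prod_mul_distrib, ← pow_mul, Finset.prod_pow_eq_pow_sum, map_prod,
      map_pow]
  have hm : ((Nat.multinomial univ u : ℕ) : K) = (r ! : K) * (∏ j, ((u j)! : K))⁻¹ := by
    have h := Nat.multinomial_spec univ u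
    rw [(mem_piAntidiag.1 hu).1] at h
    rw [← h]
    have h0 : (∏ j, ((u j)! : K)) ≠ 0 :=
      Finset.prod_ne_zero_iff.2 fun j _ => Nat.cast_ne_zero.2 (Nat.factorial_ne_zero _)
    push_cast
    field_simp
  rw [hprod, ← C_eq_natCast, ← mul_assoc, ← C_mul, coeff_C_mul_X_pow, hm]
  by_cases hs : ∑ j, e j * u j = s
  · rw [if_pos hs.symm, if_pos hs]; ring
  · rw [if_neg (Ne.symm hs), if_neg hs]

/-- Logarithmic derivative cleared of denominators: each factor contributes the geometric series of
`-ρ / (1 - ρX)`. -/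
theorem derivative_prod_one_sub_mul_X (R : Multiset K) :
    PowerSeries.derivative K (((R.map fun ρ => (1 - C ρ * X : K[X])).prod : K[X]) : PowerSeries K)
      = -((((R.map fun ρ => (1 - C ρ * X : K[X])).prod : K[X]) : PowerSeries K)
        * PowerSeries.mk fun n => (R.map fun ρ => ρ ^ (n + 1)).sum) := by
  induction R using Multiset.induction_on with
  | empty =>
    have : (PowerSeries.mk fun _ => (0 : K)) = 0 := by ext; simp
    simp [this]
  | cons ρ R ih =>
    have hsplit : (PowerSeries.mk fun n => ((ρ ::ₘ R).map fun ρ => ρ ^ (n + 1)).sum)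
        = PowerSeries.mk (fun n => ρ ^ (n + 1))
          + PowerSeries.mk fun n => (R.map fun ρ => ρ ^ (n + 1)).sum := by
      ext; simp
    have hgeom : ((1 - C ρ * X : K[X]) : PowerSeries K) * PowerSeries.mk (fun n => ρ ^ (n + 1))
        = PowerSeries.C ρ := by
      ext n
      cases n with
      | zero => simp [sub_mul, mul_assoc]
      | succ n =>
        simp [sub_mul, mul_assoc, PowerSeries.coeff_succ_X_mul]
        ring
    have hder : PowerSeries.derivative K ((1 - C ρ * X : K[X]) : PowerSeries K)
        = -PowerSeries.C ρ := by
      rw [PowerSeries.derivative_coe]; simp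
    rw [Multiset.map_cons, Multiset.prod_cons, Polynomial.coe_mul, Derivation.leibniz, ih, hsplit,
      hder, smul_eq_mul, smul_eq_mul, mul_add, ← hgeom]
    ring

/-- If `∏ (1 - ρ X) = 1 + H` with `X ∣ H`, then `-∑ ρ^s / s` is the coefficient of `X^s` in
`log (1 + H)`, where the logarithm may be truncated after `H^s`. -/
theorem sum_pow_eq_coeff_log [CharZero K] (R : Multiset K) (H : K[X]) (hX : X ∣ H)
    (hR : (R.map fun ρ => (1 - C ρ * X : K[X])).prod = 1 + H) (s : ℕ) (hs : 0 < s) :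
    (R.map fun ρ => ρ ^ s).sum
      = (s : K) * ∑ r ∈ Icc 1 s, (-1 : K) ^ r * (r : K)⁻¹ * (H ^ r).coeff s := by
  set P : PowerSeries K := PowerSeries.mk fun n => (R.map fun ρ => ρ ^ (n + 1)).sum
  -- `L` is `-log (1 + H)` truncated after `H^s`; its derivative should approximate `P = -H' / (1 +
  -- H)`.
  set L : K[X] := ∑ r ∈ range s, C ((-1) ^ (r + 1) * ((r + 1 : ℕ) : K)⁻¹) * H ^ (r + 1)
  have hL : derivative L = -derivative H * ∑ r ∈ range s, (-H) ^ r := by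
    rw [derivative_sum, Finset.mul_sum]
    refine Finset.sum_congr rfl fun r _ => ?_
    have : ((r + 1 : ℕ) : K) ≠ 0 := Nat.cast_ne_zero.2 (Nat.succ_ne_zero r)
    rw [derivative_C_mul, derivative_pow, Nat.add_sub_cancel, ← mul_assoc, ← mul_assoc, ← C_mul,
      mul_assoc _ _ (((r + 1 : ℕ) : K)), inv_mul_cancel₀ this, neg_pow H]
    simp only [mul_one, C_pow, C_neg, C_1]
    ring
  have hGL : (1 + H) * derivative L = -derivative H * (1 - (-H) ^ s) := by
    have := geom_sum_mul_neg (-H) s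
    rw [hL]
    linear_combination (-derivative H) * this
  have hGP : derivative H = (-(((1 + H : K[X]) : PowerSeries K) * P) : PowerSeries K) := by
    have := derivative_prod_one_sub_mul_X R
    rw [hR, PowerSeries.derivative_coe] at this
    simpa using this
  -- The unit `1 + H` may be multiplied in; the geometric sum telescopes and leaves the error `H'
  -- (-H)^s`.
  have hdvd : (PowerSeries.X : PowerSeries K) ^ s ∣ (derivative L : K[X]) - P := by
    have hunit : IsUnit ((1 + H : K[X]) : PowerSeries K) := by
      rw [PowerSeries.isUnit_iff_constantCoeff]
      obtain ⟨Q, rfl⟩ := hX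
      simp
    rw [← hunit.dvd_mul_left]
    have h1 : ((1 + H : K[X]) : PowerSeries K) * ((derivative L : K[X]) - P)
        = ((derivative H * (-H) ^ s : K[X]) : PowerSeries K) := by
      rw [mul_sub, ← Polynomial.coe_mul, hGL]
      have : (((1 + H : K[X]) : PowerSeries K) * P) = -((derivative H : K[X]) : PowerSeries K) := by
        rw [hGP, neg_neg]
      rw [this]
      push_cast
      ring
    rw [h1, ← Polynomial.coe_X, ← Polynomial.coe_pow]
    have h2 : (X : K[X]) ^ s ∣ derivative H * (-H) ^ s :=
      Dvd.dvd.mul_left (pow_dvd_pow_of_dvd (by simpa using hX) s) _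
    obtain ⟨Q, hQ⟩ := h2
    exact ⟨(Q : PowerSeries K), by rw [hQ, Polynomial.coe_mul]⟩
  -- The coefficient of `X^(s-1)` in `L'` is `s` times that of `X^s` in `L`, so agreement modulo
  -- `X^s` just suffices.
  have hc := (PowerSeries.X_pow_dvd_iff.1 hdvd) (s - 1) (by omega)
  obtain ⟨t, rfl⟩ : ∃ t, s = t + 1 := ⟨s - 1, by omega⟩
  rw [map_sub, sub_eq_zero, Nat.add_sub_cancel, Polynomial.coeff_coe, Polynomial.coeff_derivative,
    PowerSeries.coeff_mk] at hc
  rw [← hc, mul_comm, finsetSum_coeff, ← Finset.Ico_add_one_right_eq_Icc,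
    Finset.sum_Ico_eq_sum_range]
  push_cast
  simp only [coeff_C_mul, add_comm 1, add_comm (1 : K)]

end Core
end MonomialCurve

namespace MonomialCurve

open Finset Polynomial

/-! ### Multinomial expansion of power sums -/

section Expansion

variable {K : Type*} [Field K] {ι : Type*} [Fintype ι] [DecidableEq ι]

theorem weightSum_eq_zero (a : ι → K) {e : ι → ℕ} (he : ∀ j, 0 < e j) {r s : ℕ} (h : s < r) :
    weightSum a e r s = 0 := by
  rw [weightSum, Finset.filter_false_of_mem, Finset.sum_empty]
  intro u hu hs
  have hle : ∑ j, u j ≤ ∑ j, e j * u j :=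
    Finset.sum_le_sum fun j _ => Nat.le_mul_of_pos_left _ (he j)
  rw [(mem_piAntidiag.1 hu).1, hs] at hle
  omega

/-- Homogeneity of degree `r`: the source of the denominators `x_d^r` and `x_0^r`. -/
theorem weightSum_div (a : ι → K) (c : K) (e : ι → ℕ) (r s : ℕ) :
    weightSum (fun j => a j / c) e r s = weightSum a e r s / c ^ r := by
  rw [weightSum, weightSum, Finset.sum_div]
  refine Finset.sum_congr rfl fun u hu => ?_
  have hr : ∑ j, u j = r := (mem_piAntidiag.1 (Finset.mem_filter.1 hu).1).1
  simp only [div_pow, Finset.prod_div_distrib, Finset.prod_pow_eq_pow_sum, hr]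
  ring

theorem sum_pow_eq_sum_weightSum [CharZero K] (R : Multiset K) (a : ι → K) {e : ι → ℕ}
    (he : ∀ j, 0 < e j)
    (hR : (R.map fun ρ => (1 - C ρ * X : K[X])).prod = 1 + ∑ j, C (a j) * X ^ e j)
    {s : ℕ} (hs : 0 < s) :
    (R.map fun ρ => ρ ^ s).sum
      = (s : K) * ∑ r ∈ Icc 1 s, (-1 : K) ^ r * ((r - 1)! : K) * weightSum a e r s := by
  rw [sum_pow_eq_coeff_log R _ _ hR s hs]
  · congr 1
    refine Finset.sum_congr rfl fun r hr => ?_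
    have hr1 : 1 ≤ r := (Finset.mem_Icc.1 hr).1
    have hr0 : (r : K) ≠ 0 := Nat.cast_ne_zero.2 (by omega)
    rw [coeff_pow_sum_C_mul_X_pow, ← Nat.mul_factorial_pred (by omega : r ≠ 0)]
    push_cast
    field_simp
  · exact Finset.dvd_sum fun j _ => (dvd_pow_self X (he j).ne').mul_left _

theorem finsum_weightSum (a : ι → K) {e : ι → ℕ} (he : ∀ j, 0 < e j) (s : ℕ) :
    ∑ᶠ (r : ℕ) (_ : 1 ≤ r), (-1 : K) ^ r * ((r - 1)! : K) * weightSum a e r s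
      = ∑ r ∈ Icc 1 s, (-1 : K) ^ r * ((r - 1)! : K) * weightSum a e r s := by
  refine finsum_mem_eq_sum_of_inter_support_eq (s := {r : ℕ | 1 ≤ r}) _ ?_
  ext r
  simp only [Set.mem_inter_iff, Set.mem_ofPred_eq, Function.mem_support, Finset.coe_Icc,
    Set.mem_Icc, and_congr_left_iff, iff_self_and]
  intro h _
  by_contra hlt
  exact h (by rw [weightSum_eq_zero a he (not_le.1 hlt), mul_zero])

end Expansion

/-! ### Hypergeometric polynomials as weight sums -/

section Hypergeometric

variable {K : Type*} [Field K]

theorem eval_hypPoly_curveMatrix {n : ℕ} (k : Fin n → ℕ) (y : Fin n → K) (r : ℕ) (b : ℤ) :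
    MvPolynomial.eval y (hypPoly K (curveMatrix k) ![(r : ℤ), b])
      = ∑ u ∈ (piAntidiag univ r).filter (fun u : Fin n → ℕ => ∑ j, (k j : ℤ) * u j = b),
          (∏ j, y j ^ u j) * (∏ j, ((u j)! : K))⁻¹ := by
  rw [hypPoly, finsum_mem_eq_finite_toFinset_sum _ (fiber_finite k _), map_sum]
  refine Finset.sum_equiv Finsupp.equivFunOnFinite (fun u => ?_) (fun u _ => ?_)
  · simp [mem_fiber_curveMatrix, ← Nat.cast_sum]
  · rw [MvPolynomial.eval_monomial, Finsupp.prod_fintype _ _ (by simp), mul_comm]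
    rfl

variable {m : ℕ} (k : Fin (m + 2) → ℕ) (x : Fin (m + 2) → K)

/-- Given `∑ u_j = r`, the conditions `∑ k_j u_j = rd - s` and `∑ (d - k_j) u_j = s` coincide; the
subtraction in `ℕ` is exact because `k_j ≤ d`. -/
theorem eval_hypPoly_matB (hk : StrictMono k) (r s : ℕ) :
    MvPolynomial.eval (fun j : Fin (m + 1) => x j.castSucc)
        (hypPoly K (matB k) ![(r : ℤ), (r : ℤ) * (deg k : ℤ) - s]) / x (Fin.last (m + 1)) ^ r
      = weightSum (fun j : Fin (m + 1) => x j.castSucc / x (Fin.last (m + 1)))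
          (fun j => deg k - k j.castSucc) r s := by
  rw [weightSum_div, matB, eval_hypPoly_curveMatrix, weightSum]
  congr 1
  refine Finset.sum_congr (Finset.filter_congr fun u hu => ?_) fun _ _ => rfl
  have hr : ∑ j, (u j : ℤ) = r := by exact_mod_cast (mem_piAntidiag.1 hu).1
  have hcast : ((∑ j, (deg k - k j.castSucc) * u j : ℕ) : ℤ)
      = r * deg k - ∑ j : Fin (m + 1), (k j.castSucc : ℤ) * u j := by
    rw [← hr, Finset.sum_mul, ← Finset.sum_sub_distrib]
    push_cast
    refine Finset.sum_congr rfl fun j _ => ?_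
    have : k j.castSucc ≤ deg k := (hk (Fin.castSucc_lt_last j)).le
    rw [Nat.cast_sub this]
    ring
  omega

theorem eval_hypPoly_matC (r s : ℕ) :
    MvPolynomial.eval (fun j : Fin (m + 1) => x j.succ)
        (hypPoly K (matC k) ![(r : ℤ), (s : ℤ)]) / x 0 ^ r
      = weightSum (fun j : Fin (m + 1) => x j.succ / x 0) (fun j => k j.succ) r s := by
  rw [weightSum_div, matC, eval_hypPoly_curveMatrix, weightSum]
  congr 1
  refine Finset.sum_congr (Finset.filter_congr fun u _ => ?_) fun _ _ => rfl
  rw [← Nat.cast_inj (R := ℤ)]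
  push_cast
  rfl

end Hypergeometric

/-! ### Factorisations of the generic polynomial -/

section Roots

variable {K : Type*} [Field K] {m : ℕ} {k : Fin (m + 2) → ℕ} {x : Fin (m + 2) → K}

theorem genPoly_eq_last : genPoly k x
    = ∑ j : Fin (m + 1), C (x j.castSucc) * X ^ k j.castSucc
      + C (x (Fin.last (m + 1))) * X ^ deg k := by
  rw [genPoly, Fin.sum_univ_castSucc, deg]

theorem genPoly_eq_zero (hk0 : k 0 = 0) : genPoly k x
    = C (x 0) + ∑ j : Fin (m + 1), C (x j.succ) * X ^ k j.succ := by
  rw [genPoly, Fin.sum_univ_succ, hk0, pow_zero, mul_one]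

theorem degree_sum_castSucc_lt (hk : StrictMono k) :
    (∑ j : Fin (m + 1), C (x j.castSucc) * X ^ k j.castSucc).degree < (deg k : WithBot ℕ) := by
  refine (Polynomial.degree_sum_le _ _).trans_lt ((Finset.sup_lt_iff (WithBot.bot_lt_coe _)).2 ?_)
  intro j _
  exact (degree_C_mul_X_pow_le _ _).trans_lt (Nat.cast_lt.2 (hk (Fin.castSucc_lt_last j)))

theorem degree_genPoly (hk : StrictMono k) (hxd : x (Fin.last (m + 1)) ≠ 0) :
    (genPoly k x).degree = deg k := by
  rw [genPoly_eq_last, degree_add_eq_right_of_degree_lt, degree_C_mul_X_pow _ hxd]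
  rw [degree_C_mul_X_pow _ hxd]
  exact degree_sum_castSucc_lt hk

theorem natDegree_genPoly (hk : StrictMono k) (hxd : x (Fin.last (m + 1)) ≠ 0) :
    (genPoly k x).natDegree = deg k :=
  natDegree_eq_of_degree_eq_some (degree_genPoly hk hxd)

theorem leadingCoeff_genPoly (hk : StrictMono k) (hxd : x (Fin.last (m + 1)) ≠ 0) :
    (genPoly k x).leadingCoeff = x (Fin.last (m + 1)) := by
  rw [genPoly_eq_last, leadingCoeff_add_of_degree_lt, leadingCoeff_C_mul_X_pow]
  rw [degree_C_mul_X_pow _ hxd]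
  exact degree_sum_castSucc_lt hk

theorem reflect_sum {ι : Type*} (N : ℕ) (t : Finset ι) (f : ι → K[X]) :
    reflect N (∑ j ∈ t, f j) = ∑ j ∈ t, reflect N (f j) :=
  map_sum (AddMonoidHom.mk' (reflect N) fun f g => reflect_add f g N) f t

/-- Reversal is multiplicative over a domain. A zero root yields the factor `1`, so `x_0 = 0` does
no harm. -/
theorem reverse_prod_X_sub_C (R : Multiset K) :
    (R.map fun ρ => (X - C ρ : K[X])).prod.reverse = (R.map fun ρ => (1 - C ρ * X : K[X])).prod := by
  induction R using Multiset.induction_on with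
  | empty => simpa using reverse_C (1 : K)
  | cons ρ R ih =>
    have h : (X - C ρ : K[X]).reverse = 1 - C ρ * X := by
      rw [reverse, natDegree_X_sub_C, reflect_sub, reflect_one_X, reflect_C, pow_one]
    rw [Multiset.map_cons, Multiset.prod_cons, reverse_mul_of_domain, ih, h, Multiset.map_cons,
      Multiset.prod_cons]

theorem prod_one_sub_inv_mul_X {R : Multiset K} (hR : (0 : K) ∉ R) :
    (R.map fun ρ => (X - C ρ : K[X])).prod
      = C (R.map fun ρ => -ρ).prod
        * ((R.map fun ρ => ρ⁻¹).map fun ρ => (1 - C ρ * X : K[X])).prod := by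
  rw [map_multiset_prod, Multiset.map_map, Multiset.map_map, ← Multiset.prod_map_mul]
  refine congrArg _ (Multiset.map_congr rfl fun ρ hρ => ?_)
  have h0 : ρ ≠ 0 := fun h => hR (h ▸ hρ)
  simp only [Function.comp_apply, mul_sub, mul_one, ← mul_assoc, ← C_mul, neg_mul,
    mul_inv_cancel₀ h0, C_neg, C_1]
  ring

variable [IsAlgClosed K]

theorem genPoly_eq_prod_roots (hk : StrictMono k) (hxd : x (Fin.last (m + 1)) ≠ 0) :
    genPoly k x = C (x (Fin.last (m + 1)))
      * ((genPoly k x).roots.map fun ρ => (X - C ρ : K[X])).prod := by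
  conv_lhs => rw [(IsAlgClosed.splits (genPoly k x)).eq_prod_roots, leadingCoeff_genPoly hk hxd]

theorem card_roots_genPoly (hk : StrictMono k) (hxd : x (Fin.last (m + 1)) ≠ 0) :
    (genPoly k x).roots.card = deg k := by
  rw [splits_iff_card_roots.1 (IsAlgClosed.splits _), natDegree_genPoly hk hxd]

theorem prod_one_sub_roots_mul_X (hk : StrictMono k) (hxd : x (Fin.last (m + 1)) ≠ 0) :
    ((genPoly k x).roots.map fun ρ => (1 - C ρ * X : K[X])).prod
      = 1 + ∑ j : Fin (m + 1),
          C (x j.castSucc / x (Fin.last (m + 1))) * X ^ (deg k - k j.castSucc) := by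
  have h : C (x (Fin.last (m + 1)))
        * ((genPoly k x).roots.map fun ρ => (1 - C ρ * X : K[X])).prod
      = C (x (Fin.last (m + 1))) + ∑ j : Fin (m + 1),
          C (x j.castSucc) * X ^ (deg k - k j.castSucc) := by
    -- `reverse` is multiplicative but not additive, so it is unfolded to `reflect` at the exact
    -- degree `d`, which acts termwise.
    rw [← reverse_prod_X_sub_C, ← reverse_C (x (Fin.last (m + 1))), ← reverse_mul_of_domain,
      ← genPoly_eq_prod_roots hk hxd, reverse, natDegree_genPoly hk hxd, genPoly_eq_last,
      reflect_add, reflect_sum, reverse_C, reflect_C_mul_X_pow, revAt_le le_rfl, Nat.sub_self,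
      pow_zero, mul_one, add_comm]
    congr 1
    refine Finset.sum_congr rfl fun j _ => ?_
    have hle : k j.castSucc ≤ deg k := (hk (Fin.castSucc_lt_last j)).le
    rw [reflect_C_mul_X_pow, revAt_le hle]
  refine mul_left_cancel₀ (C_ne_zero.2 hxd) (h.trans ?_)
  rw [mul_add, mul_one, Finset.mul_sum]
  simp only [← mul_assoc, ← C_mul, mul_div_cancel₀ _ hxd]

theorem prod_one_sub_inv_roots_mul_X (hk : StrictMono k) (hk0 : k 0 = 0)
    (hxd : x (Fin.last (m + 1)) ≠ 0) (hx0 : x 0 ≠ 0) :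
    (((genPoly k x).roots.map fun ρ => ρ⁻¹).map fun ρ => (1 - C ρ * X : K[X])).prod
      = 1 + ∑ j : Fin (m + 1), C (x j.succ / x 0) * X ^ k j.succ := by
  have hpos : ∀ j : Fin (m + 1), k j.succ ≠ 0 := fun j => (pos_of_gt (hk (Fin.succ_pos j))).ne'
  have heval : (genPoly k x).eval 0 = x 0 := by
    rw [genPoly_eq_zero hk0]
    simp [eval_finsetSum, hpos]
  have hroots : (0 : K) ∉ (genPoly k x).roots := fun h =>
    hx0 (heval ▸ (isRoot_of_mem_roots h))
  have hprod := genPoly_eq_prod_roots hk hxd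
  rw [prod_one_sub_inv_mul_X hroots, ← mul_assoc, ← C_mul] at hprod
  set c := x (Fin.last (m + 1)) * ((genPoly k x).roots.map fun ρ => -ρ).prod
  -- Evaluate at `0`, where every factor `1 - ρ⁻¹X` is `1`.
  have hc : c = x 0 := by
    have h := congrArg (eval 0) hprod
    rw [heval, eval_mul, eval_C, eval_multiset_prod] at h
    simpa using h.symm
  rw [hc] at hprod
  refine mul_left_cancel₀ (C_ne_zero.2 hx0) (hprod.symm.trans ?_)
  rw [genPoly_eq_zero hk0, mul_add, mul_one, Finset.mul_sum]
  simp only [← mul_assoc, ← C_mul, mul_div_cancel₀ _ hx0]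

end Roots

/-! ### Girard's formula -/

section Girard

variable {K : Type*} [Field K]

theorem prod_one_sub_mul_X_eq_sum_esymm (R : Multiset K) {d : ℕ} (hd : R.card = d) :
    (R.map fun ρ => (1 - C ρ * X : K[X])).prod
      = 1 + ∑ j : Fin d, C ((-1) ^ ((j : ℕ) + 1) * R.esymm (j + 1)) * X ^ ((j : ℕ) + 1) := by
  have hdeg : (R.map fun ρ => (X - C ρ : K[X])).prod.natDegree = d := by
    rw [natDegree_multiset_prod_X_sub_C_eq_card, hd]
  rw [← reverse_prod_X_sub_C, reverse, hdeg, Multiset.prod_X_sub_X_eq_sum_esymm, reflect_sum, hd,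
    Finset.sum_range_succ', add_comm, Finset.sum_range]
  have h : ∀ j ≤ d, reflect d ((-1) ^ j * (C (R.esymm j) * X ^ (d - j)))
      = C ((-1) ^ j * R.esymm j) * X ^ j := fun j hj => by
    rw [← mul_assoc, ← C_1, ← C_neg, ← C_pow, ← C_mul, reflect_C_mul_X_pow,
      revAt_le (Nat.sub_le _ _), Nat.sub_sub_self hj]
  rw [h 0 (Nat.zero_le _)]
  congr 1
  · simp [Multiset.esymm]
  · exact Finset.sum_congr rfl fun j _ => h _ j.2

/-- Girard's formula for the power sums of a multiset. -/
theorem sum_pow_eq_sum_girardIndex [CharZero K] (R : Multiset K) {d : ℕ} (hd : R.card = d)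
    {s : ℕ} (hs : 0 < s) :
    (R.map fun ρ => ρ ^ s).sum
      = (s : K) * ∑ i ∈ girardIndex d s,
          (-1 : K) ^ (s + ∑ j, i j) * (((∑ j, i j) - 1)! : K) / (∏ j, ((i j)! : K)) *
            ∏ j : Fin d, R.esymm ((j : ℕ) + 1) ^ i j := by
  rw [sum_pow_eq_sum_weightSum R _ (fun j => Nat.succ_pos _)
    (prod_one_sub_mul_X_eq_sum_esymm R hd) hs]
  congr 1
  -- Tuples are grouped by `r = ∑ i_j`; since `s > 0` the zero tuple is excluded, so `r ≥ 1`.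
  have hmaps : ∀ i ∈ girardIndex d s, ∑ j, i j ∈ Icc 1 s := fun i hi => by
    rw [mem_girardIndex] at hi
    have hle : ∑ j, i j ≤ ∑ j : Fin d, ((j : ℕ) + 1) * i j :=
      Finset.sum_le_sum fun j _ => Nat.le_mul_of_pos_left _ (Nat.succ_pos _)
    refine Finset.mem_Icc.2 ⟨Nat.one_le_iff_ne_zero.2 fun h0 => ?_, hi ▸ hle⟩
    have hi0 := Finset.sum_eq_zero_iff.1 h0
    rw [Finset.sum_eq_zero fun j hj => by rw [hi0 j hj, mul_zero]] at hi
    omega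
  rw [← Finset.sum_fiberwise_of_maps_to hmaps]
  refine Finset.sum_congr rfl fun r _ => ?_
  rw [weightSum, Finset.mul_sum]
  refine Finset.sum_congr ?_ fun i hi => ?_
  · ext i
    simp [mem_girardIndex, and_comm]
  · obtain ⟨hi, hr⟩ := Finset.mem_filter.1 hi
    rw [mem_girardIndex] at hi
    -- The signs of the coefficients multiply to `(-1)^(∑ (j+1) i_j) = (-1)^s`.
    simp only [mul_pow, Finset.prod_mul_distrib, ← pow_mul, Finset.prod_pow_eq_pow_sum, hi, hr]
    ring

end Girard

end MonomialCurve

/-! ### The three formulas -/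

theorem corollary1p12 {K : Type*} [Field K] [IsAlgClosed K] [CharZero K] {m : ℕ}
    (k : Fin (m + 2) → ℕ) (hk : StrictMono k) (hk0 : k 0 = 0)
    (x : Fin (m + 2) → K) (hxd : x (Fin.last (m + 1)) ≠ 0) :
    -- positive powers
    (∀ s : ℤ, 0 < s →
      MonomialCurve.powerSum k x s = (s : K) * MonomialCurve.PsiD k ![0, -s] x ∧
      MonomialCurve.powerSum k x s =
        (s : K) * ∑ r ∈ Finset.Icc 1 s.toNat, (-1 : K) ^ r * ((r - 1)! : K) *
          (MvPolynomial.eval (fun j : Fin (m + 1) => x j.castSucc)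
            (MonomialCurve.hypPoly K (MonomialCurve.matB k)
              ![(r : ℤ), (r : ℤ) * (MonomialCurve.deg k : ℤ) - s]) /
            x (Fin.last (m + 1)) ^ r)) ∧
    -- negative powers
    (x 0 ≠ 0 → ∀ s : ℤ, s < 0 →
      MonomialCurve.powerSum k x s = (-s : K) * MonomialCurve.PsiZero k ![0, -s] x ∧
      MonomialCurve.powerSum k x s =
        (-s : K) * ∑ r ∈ Finset.Icc 1 (-s).toNat, (-1 : K) ^ r * ((r - 1)! : K) *
          (MvPolynomial.eval (fun j : Fin (m + 1) => x j.succ)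
            (MonomialCurve.hypPoly K (MonomialCurve.matC k) ![(r : ℤ), -s]) / x 0 ^ r)) ∧
    -- Girard's formula in the elementary symmetric functions of the roots
    (∀ s : ℕ, 0 < s →
      MonomialCurve.powerSum k x (s : ℤ) =
        (s : K) * ∑ i ∈ MonomialCurve.girardIndex (MonomialCurve.deg k) s,
          (-1 : K) ^ (s + ∑ j, i j) * (((∑ j, i j) - 1)! : K) / (∏ j, ((i j)! : K)) *
            ∏ j : Fin (MonomialCurve.deg k), (MonomialCurve.genPoly k x).roots.esymm ((j : ℕ) + 1) ^ i j) := by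
  refine ⟨fun s hs => ?_, fun hx0 s hs => ?_, fun s hs => ?_⟩
  · lift s to ℕ using hs.le
    have hs' : 0 < s := by exact_mod_cast hs
    have he : ∀ j : Fin (m + 1), 0 < MonomialCurve.deg k - k j.castSucc := fun j =>
      Nat.sub_pos_of_lt (hk (Fin.castSucc_lt_last j))
    have hα : ∀ r : ℕ, ![0, -(s : ℤ)] + (r : ℤ) • ![1, (MonomialCurve.deg k : ℤ)]
        = ![(r : ℤ), (r : ℤ) * (MonomialCurve.deg k : ℤ) - s] := fun r => by
      ext i
      fin_cases i
      · simp
      · simp [neg_add_eq_sub]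
    simp only [MonomialCurve.PsiD, hα, MonomialCurve.eval_hypPoly_matB k x hk,
      MonomialCurve.finsum_weightSum _ he, MonomialCurve.powerSum, zpow_natCast, Int.toNat_natCast,
      Int.cast_natCast, and_self]
    exact MonomialCurve.sum_pow_eq_sum_weightSum _ _ he
      (MonomialCurve.prod_one_sub_roots_mul_X hk hxd) hs'
  · obtain ⟨s, rfl⟩ : ∃ n : ℕ, s = -(n : ℤ) := ⟨(-s).toNat, by omega⟩
    have hs' : 0 < s := by omega
    have he : ∀ j : Fin (m + 1), 0 < k j.succ := fun j => pos_of_gt (hk (Fin.succ_pos j))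
    have hα : ∀ r : ℕ, ![0, (s : ℤ)] + (r : ℤ) • ![1, 0] = ![(r : ℤ), (s : ℤ)] := fun r => by
      ext i
      fin_cases i <;> simp
    simp only [neg_neg, MonomialCurve.PsiZero, hα, MonomialCurve.eval_hypPoly_matC k x,
      MonomialCurve.finsum_weightSum _ he, MonomialCurve.powerSum, Int.toNat_natCast,
      Int.cast_neg, Int.cast_natCast, and_self]
    -- The right side is the `s`-th power sum of the inverse roots.
    rw [← MonomialCurve.sum_pow_eq_sum_weightSum _ _ he
      (MonomialCurve.prod_one_sub_inv_roots_mul_X hk hk0 hxd hx0) hs', Multiset.map_map]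
    simp
  · simp only [MonomialCurve.powerSum, zpow_natCast]
    exact MonomialCurve.sum_pow_eq_sum_girardIndex _ (MonomialCurve.card_roots_genPoly hk hxd) hs
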